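/- Fix an integer $k\ge 1$ and let $D_k=\{0,\tfrac1k,\tfrac2k,\dots,\tfrac{k-1}{k},1\}$. Fix a probability distribution on $D_k$, not depending on $n$, such that a random variable $X$ with this distribution satisfies $0<P(X=a)=P(X=1-a)$ for every $a\in D_k$; let $\mu$ and $\sigma$ be the mean and the standard deviation of this distribution. For each $n$, consider a round-robin tournament with $n$ players (model $M_k$): for $i\ne j$, $X_{ij}$ is the payoff of player $i$ in the game against player $j$; every $X_{ij}$ ($i\neq j$) has the given distribution, $X_{ij}+X_{ji}=1$, and the $\binom n2$ pairs $(X_{ij},X_{ji})$, $1\le i<j\le n$, are independent. Let $s_i(n)=\sum_{j\ne i}X_{ij}$ be the score of player $i$. Fix $\epsilon>0$ and, for all sufficiently large $n$, put $$x_n=\bigl[2\log(n-1)-(1+\epsilon)\log\log(n-1)\bigr]^{1/2},\qquad t_n=(n-1)\mu+x_n(n-1)^{1/2}\sigma,$$ and let $$W_n(t_n)=\sum_{1\le v<u\le n} I\bigl(t_n<s_u(n)=s_v(n)\bigr)$$ be the number of pairs of players with equal scores exceeding $t_n$. Then $$\lim_{n\to\infty}P\bigl(W_n(t_n)=0\bigr)=1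 .$$ -/

import Mathlib

open MeasureTheory ProbabilityTheory Filter Topology

noncomputable section

namespace RoundRobin

/-- The set `D_k = {0, 1/k, 2/k, …, 1}` of the possible payoffs of a game. -/
def payoffs (k : ℕ) : Set ℝ := {a | ∃ i : ℕ, i ≤ k ∧ a = (i : ℝ) / (k : ℝ)}

/-- The probability measure `ν` on `ℝ` is an admissible law of the payoff of one game: it is
concentrated on `D_k`, and `0 < ν {a} = ν {1 - a}` for every `a ∈ D_k`. -/
structure IsPayoffLaw (k : ℕ) (ν : Measure ℝ) : Prop where
  isProbabilityMeasure : IsProbabilityMeasure ν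
  concentrated : ∀ᵐ a ∂ν, a ∈ payoffs k
  pos : ∀ a ∈ payoffs k, 0 < ν {a}
  symm : ∀ a ∈ payoffs k, ν {a} = ν {1 - a}

/-- Model `M_k` with `n` players and payoff law `ν`: `X i j` is the payoff of player `i` in the
game against player `j`. The diagonal entries `X i i` play no role. -/
structure IsTournament (k : ℕ) (ν : Measure ℝ) {Ω : Type*} [MeasurableSpace Ω] (P : Measure Ω)
    (n : ℕ) (X : Fin n → Fin n → Ω → ℝ) : Prop where
  payoffLaw : IsPayoffLaw k ν
  measurable : ∀ i j, i ≠ j → Measurable (X i j)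
  add_eq_one : ∀ i j, i ≠ j → ∀ᵐ ω ∂P, X i j ω + X j i ω = 1
  law : ∀ i j, i ≠ j → P.map (X i j) = ν
  indep : iIndepFun
    (fun (q : {q : Fin n × Fin n // q.1 < q.2}) (ω : Ω) =>
      (X q.1.1 q.1.2 ω, X q.1.2 q.1.1 ω)) P

/-- The score `s_i(n) = ∑_{j ≠ i} X_{ij}` of player `i`. -/
def score {Ω : Type*} {n : ℕ} (X : Fin n → Fin n → Ω → ℝ) (i : Fin n) (ω : Ω) : ℝ :=
  ∑ j ∈ Finset.univ.erase i, X i j ω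

open Classical in
/-- The number `W_n(t)` of pairs `v < u` of players with equal scores exceeding `t`. -/
def tiedPairs {Ω : Type*} {n : ℕ} (X : Fin n → Fin n → Ω → ℝ) (t : ℝ) (ω : Ω) : ℕ :=
  ∑ v : Fin n, ∑ u ∈ Finset.Ioi v,
    if t < score X u ω ∧ score X u ω = score X v ω then 1 else 0

/-- The mean `μ` of the payoff of one game. -/
def payoffMean (ν : Measure ℝ) : ℝ := ∫ a, a ∂ν

/-- The standard deviation `σ` of the payoff of one game. -/
def payoffStd (ν : Measure ℝ) : ℝ := √(variance (fun a : ℝ => a) ν)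

/-- `x_n = (2 log (n - 1) - (1 + ε) log (log (n - 1)))^{1/2}`. -/
def xSeq (ε : ℝ) (n : ℕ) : ℝ :=
  √(2 * Real.log ((n : ℝ) - 1) - (1 + ε) * Real.log (Real.log ((n : ℝ) - 1)))

/-- The threshold `t_n = (n - 1) μ + x_n (n - 1)^{1/2} σ`. -/
def threshold (ν : Measure ℝ) (ε : ℝ) (n : ℕ) : ℝ :=
  ((n : ℝ) - 1) * payoffMean ν + xSeq ε n * √((n : ℝ) - 1) * payoffStd ν

end RoundRobin

end

/-!
By the union bound it suffices that the probability `p` of a tie above `t_n` between two given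
players `u ≠ v` is `o(n⁻²)`. For any `θ ≥ 0` the indicator of such a tie is at most
`exp (θ (s_u + s_v - 2 t_n))` times the indicator of `s_u = s_v`, and since `k (s_u - s_v)` is
an integer, the latter is the mean over `τ ∈ [-π, π]` of `exp (i τ k (s_u - s_v))`
(`indicator_tie_le`). After Fubini, independence of the games turns the expectation of the product
into powers of the complex moment generating function `φ` of the payoff law
(`IsTournament.integral_cexp_scores`), and
`p ≤ exp (θ - 2 θ t_n) ∫ |φ(θ + i k τ)| ^ (2 (n - 2)) dτ`.

Two estimates for `φ` finish the proof. The atoms at `0` and `1 / k` give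
`|φ(θ + i k τ)| ≤ φ(θ) exp (-c τ²)` on `[-π, π]` uniformly in `θ ∈ [0, 1]`
(`IsPayoffLaw.exists_norm_complexMGF_le`), so the integral over `τ` is
`O(n ^ (-1/2)) φ(θ) ^ (2 (n - 2))`. The expansion
`φ(θ) ≤ exp (θ μ + θ² σ² / 2 + θ³)` (`IsPayoffLaw.mgf_le`) with
`θ = x_n / (σ √(n - 1))` bounds what remains by a constant times
`exp (-x_n²) = (n - 1)⁻² (log (n - 1)) ^ (1 + ε)`. Altogether the expected number of ties above
`t_n` is `O(n ^ (-1/2) (log n) ^ (1 + ε))`.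
-/

noncomputable section

namespace RoundRobin

/-! ### The moment generating function of the payoff law -/

section PayoffLaw

variable {k : ℕ} {ν : Measure ℝ}

lemma mem_Icc_of_mem_payoffs {a : ℝ} (ha : a ∈ payoffs k) : a ∈ Set.Icc (0 : ℝ) 1 := by
  obtain ⟨i, hi, rfl⟩ := ha
  exact ⟨by positivity, div_le_one_of_le₀ (by exact_mod_cast hi) (by positivity)⟩

lemma zero_mem_payoffs : (0 : ℝ) ∈ payoffs k := ⟨0, by simp, by simp⟩

lemma inv_mem_payoffs (hk : 1 ≤ k) : (k : ℝ)⁻¹ ∈ payoffs k := ⟨1, hk, by simp⟩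

lemma IsPayoffLaw.ae_mem_Icc (h : IsPayoffLaw k ν) : ∀ᵐ a ∂ν, a ∈ Set.Icc (0 : ℝ) 1 :=
  h.concentrated.mono fun _ => mem_Icc_of_mem_payoffs

/-- A continuous function is integrable against a payoff law, which lives on `[0, 1]`. -/
lemma IsPayoffLaw.integrable_of_continuous (h : IsPayoffLaw k ν) {E : Type*}
    [NormedAddCommGroup E] [SecondCountableTopology E] {f : ℝ → E}
    (hf : Continuous f) : Integrable f ν := by
  have := h.isProbabilityMeasure
  obtain ⟨C, hC⟩ := isCompact_Icc.exists_bound_of_continuousOn (s := Set.Icc (0 : ℝ) 1)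
    hf.continuousOn
  exact .of_bound hf.aestronglyMeasurable C (h.ae_mem_Icc.mono hC)

lemma IsPayoffLaw.payoffMean_mem_Icc (h : IsPayoffLaw k ν) :
    payoffMean ν ∈ Set.Icc (0 : ℝ) 1 := by
  have := h.isProbabilityMeasure
  refine ⟨integral_nonneg_of_ae (h.ae_mem_Icc.mono fun a ha => ha.1), ?_⟩
  calc payoffMean ν ≤ ∫ _, (1 : ℝ) ∂ν :=
        integral_mono_ae (h.integrable_of_continuous continuous_id) (integrable_const _)
          (h.ae_mem_Icc.mono fun a ha => ha.2)
    _ = 1 := by simp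

lemma payoffStd_sq : payoffStd ν ^ 2 = ∫ a, (a - payoffMean ν) ^ 2 ∂ν := by
  rw [payoffStd, Real.sq_sqrt (variance_nonneg _ _), variance_eq_integral (by fun_prop)]
  rfl

lemma IsPayoffLaw.real_singleton_pos (h : IsPayoffLaw k ν) {a : ℝ} (ha : a ∈ payoffs k) :
    0 < ν.real {a} := by
  have := h.isProbabilityMeasure
  exact ENNReal.toReal_pos (h.pos a ha).ne' (measure_ne_top _ _)

/-- Every payoff is an atom, so almost sure properties hold at every payoff. -/
lemma IsPayoffLaw.of_ae (h : IsPayoffLaw k ν) {p : ℝ → Prop} (hp : ∀ᵐ a ∂ν, p a) {a : ℝ}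
    (ha : a ∈ payoffs k) : p a := by
  by_contra hpa
  exact (h.pos a ha).ne' (measure_mono_null (by simpa using hpa) (ae_iff.1 hp))

lemma IsPayoffLaw.payoffStd_pos (h : IsPayoffLaw k ν) (hk : 1 ≤ k) : 0 < payoffStd ν := by
  refine lt_of_le_of_ne (Real.sqrt_nonneg _) fun h0 => ?_
  have hint : ∫ a, (a - payoffMean ν) ^ 2 ∂ν = 0 := by rw [← payoffStd_sq, ← h0]; simp
  have hcont : Continuous fun a : ℝ => (a - payoffMean ν) ^ 2 := by fun_prop
  rw [integral_eq_zero_iff_of_nonneg (fun a => sq_nonneg _)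
    (h.integrable_of_continuous hcont)] at hint
  have e0 := h.of_ae hint zero_mem_payoffs
  have e1 := h.of_ae hint (inv_mem_payoffs hk)
  simp only [Pi.zero_apply, ne_eq, OfNat.ofNat_ne_zero, not_false_eq_true, pow_eq_zero_iff] at e0 e1
  have : (0 : ℝ) < (k : ℝ)⁻¹ := by positivity
  linarith

lemma IsPayoffLaw.one_le_mgf (h : IsPayoffLaw k ν) {θ : ℝ} (hθ : 0 ≤ θ) : 1 ≤ mgf id ν θ := by
  have := h.isProbabilityMeasure
  calc (1 : ℝ) = ∫ _, (1 : ℝ) ∂ν := by simp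
    _ ≤ mgf id ν θ :=
        integral_mono_ae (integrable_const _) (h.integrable_of_continuous (by fun_prop))
          (h.ae_mem_Icc.mono fun a ha => Real.one_le_exp (mul_nonneg hθ ha.1))

lemma IsPayoffLaw.mgf_le_three (h : IsPayoffLaw k ν) {θ : ℝ} (hθ1 : θ ≤ 1) :
    mgf id ν θ ≤ 3 := by
  have := h.isProbabilityMeasure
  calc mgf id ν θ ≤ ∫ _, (3 : ℝ) ∂ν :=
        integral_mono_ae (h.integrable_of_continuous (by fun_prop)) (integrable_const _)
          (h.ae_mem_Icc.mono fun a ha => (Real.exp_le_exp.2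
            (mul_le_one₀ hθ1 ha.1 ha.2)).trans (by linarith [Real.exp_one_lt_d9]))
    _ = 3 := by simp

/-- Second-order expansion of the moment generating function, with a cubic error in the
exponent; the quadratic term carries the exact variance. -/
lemma IsPayoffLaw.mgf_le (h : IsPayoffLaw k ν) {θ : ℝ} (hθ : 0 ≤ θ) (hθ1 : θ ≤ 1) :
    mgf id ν θ ≤ Real.exp (θ * payoffMean ν + θ ^ 2 * payoffStd ν ^ 2 / 2 + θ ^ 3) := by
  have := h.isProbabilityMeasure
  set m := payoffMean ν with hm
  obtain ⟨hm0, hm1⟩ := h.payoffMean_mem_Icc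
  have hc : mgf id ν θ = Real.exp (θ * m) * ∫ a, Real.exp (θ * (a - m)) ∂ν := by
    rw [← integral_const_mul]
    refine integral_congr_ae (.of_forall fun a => ?_)
    simp only [id, ← Real.exp_add]
    congr 1; ring
  have hpt : ∀ᵐ a ∂ν, Real.exp (θ * (a - m)) ≤
      1 + θ * (a - m) + θ ^ 2 / 2 * (a - m) ^ 2 + θ ^ 3 := by
    filter_upwards [h.ae_mem_Icc] with a ha
    have hd : |a - m| ≤ 1 := abs_le.2 ⟨by linarith [ha.1], by linarith [ha.2]⟩
    have hy : |θ * (a - m)| ≤ θ := by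
      rw [abs_mul, abs_of_nonneg hθ]; exact mul_le_of_le_one_right hθ hd
    have hb := Real.exp_bound (hy.trans hθ1) (n := 3) (by norm_num)
    have h3 : |θ * (a - m)| ^ 3 ≤ θ ^ 3 := pow_le_pow_left₀ (abs_nonneg _) hy 3
    have h4 : 0 ≤ |θ * (a - m)| ^ 3 := by positivity
    simp only [Finset.sum_range_succ, Finset.sum_range_zero, Nat.factorial] at hb
    norm_num [← abs_mul, -abs_mul] at hb
    have := (abs_le.1 hb).2
    nlinarith
  have hi1 : ∫ a, (a - m) ∂ν = 0 := by
    rw [integral_sub (f := fun a : ℝ => a) (h.integrable_of_continuous continuous_id)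
      (integrable_const _)]
    simp [hm, payoffMean]
  have hle : ∫ a, Real.exp (θ * (a - m)) ∂ν ≤ 1 + θ ^ 2 * payoffStd ν ^ 2 / 2 + θ ^ 3 := by
    refine (integral_mono_ae (h.integrable_of_continuous (by fun_prop))
      (h.integrable_of_continuous (by fun_prop)) hpt).trans (le_of_eq ?_)
    rw [integral_add (h.integrable_of_continuous (by fun_prop)) (integrable_const _),
      integral_add (h.integrable_of_continuous (by fun_prop))
        (h.integrable_of_continuous (by fun_prop)),
      integral_add (integrable_const _) (h.integrable_of_continuous (by fun_prop)),
      integral_const_mul, integral_const_mul, hi1, ← payoffStd_sq]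
    simp
    ring
  rw [hc, add_assoc, Real.exp_add]
  refine mul_le_mul_of_nonneg_left (hle.trans ?_) (Real.exp_pos _).le
  linarith [Real.add_one_le_exp (θ ^ 2 * payoffStd ν ^ 2 / 2 + θ ^ 3)]

/-- Two positive masses whose phases differ by `τ` lose a definite part of their sum. -/
lemma norm_add_mul_exp_le {a b τ : ℝ} (ha : 0 < a) (hb : 0 < b) :
    ‖(a : ℂ) + b * Complex.exp (τ * Complex.I)‖ ≤
      a + b - a * b / (a + b) * (1 - Real.cos τ) := by
  have hab : 0 < a + b := by positivity
  have hc := Real.cos_le_one τ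
  have hq : a * b / (a + b) * (a + b) = a * b := by field_simp
  have hq0 : 0 ≤ a * b / (a + b) := by positivity
  have hsq : ‖(a : ℂ) + b * Complex.exp (τ * Complex.I)‖ ^ 2 =
      (a + b) ^ 2 - 2 * (a * b) * (1 - Real.cos τ) := by
    rw [Complex.exp_mul_I, ← Complex.ofReal_cos, ← Complex.ofReal_sin, Complex.sq_norm,
      Complex.normSq_apply]
    simp [-Complex.ofReal_cos, -Complex.ofReal_sin]
    linear_combination b ^ 2 * Real.sin_sq_add_cos_sq τ
  refine abs_le_of_sq_le_sq' ?_ ?_ |>.2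
  · rw [hsq]
    nlinarith [sq_nonneg (a * b / (a + b) * (1 - Real.cos τ))]
  · have h2 : a * b / (a + b) * 2 ≤ a + b := by
      rw [div_mul_eq_mul_div, div_le_iff₀ hab]; nlinarith [sq_nonneg (a - b)]
    nlinarith [Real.neg_one_le_cos τ]

/-- Gaussian decay of the tilted characteristic function over one period, uniformly in the tilt:
the atoms at `0` and `1 / k` alone produce enough cancellation. -/
lemma IsPayoffLaw.exists_norm_complexMGF_le (h : IsPayoffLaw k ν) (hk : 1 ≤ k) :
    ∃ c : ℝ, 0 < c ∧ ∀ θ : ℝ, 0 ≤ θ → θ ≤ 1 → ∀ τ : ℝ, |τ| ≤ Real.pi →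
      ‖complexMGF id ν (θ + (k * τ : ℝ) * Complex.I)‖ ≤
        mgf id ν θ * Real.exp (-(c * τ ^ 2)) := by
  have := h.isProbabilityMeasure
  have hp0 := h.real_singleton_pos zero_mem_payoffs
  have hp1 := h.real_singleton_pos (inv_mem_payoffs hk)
  set p₀ := ν.real {(0 : ℝ)}
  set p₁ := ν.real {(k : ℝ)⁻¹}
  have hk0 : (0 : ℝ) < k := by exact_mod_cast hk
  refine ⟨p₀ * p₁ / 9 * (2 / Real.pi ^ 2), by positivity, fun θ hθ hθ1 τ hτ => ?_⟩
  set z : ℂ := θ + (k * τ : ℝ) * Complex.I with hz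
  set S : Set ℝ := {0} ∪ {(k : ℝ)⁻¹}
  have hS : MeasurableSet S := (measurableSet_singleton _).union (measurableSet_singleton _)
  have hdisj : Disjoint ({0} : Set ℝ) {(k : ℝ)⁻¹} := by
    simp [hk0.ne]
  have hir : Integrable (fun a : ℝ => Real.exp (θ * a)) ν :=
    h.integrable_of_continuous (by fun_prop)
  have hic : Integrable (fun a : ℝ => Complex.exp (z * a)) ν :=
    h.integrable_of_continuous (by fun_prop)
  have hnorm : ∀ a : ℝ, ‖Complex.exp (z * a)‖ = Real.exp (θ * a) := fun a => by
    rw [Complex.norm_exp]; simp [hz]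
  set b := p₁ * Real.exp (θ * (k : ℝ)⁻¹) with hb
  have hb1 : p₁ ≤ b := le_mul_of_one_le_right hp1.le (Real.one_le_exp (by positivity))
  have hSr : ∫ a in S, Real.exp (θ * a) ∂ν = p₀ + b := by
    rw [setIntegral_union hdisj (measurableSet_singleton _) hir.integrableOn hir.integrableOn,
      integral_singleton, integral_singleton]
    simp [p₀, p₁, hb]
  have hSc : ∫ a in S, Complex.exp (z * a) ∂ν =
      (p₀ : ℂ) + (b : ℂ) * Complex.exp (τ * Complex.I) := by
    rw [setIntegral_union hdisj (measurableSet_singleton _) hic.integrableOn hic.integrableOn,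
      integral_singleton, integral_singleton, hb]
    have : z * ((k : ℝ)⁻¹ : ℝ) = ((θ * (k : ℝ)⁻¹ : ℝ) : ℂ) + τ * Complex.I := by
      have : (k : ℂ) ≠ 0 := by exact_mod_cast hk0.ne'
      rw [hz]; push_cast; field_simp
    rw [this, Complex.exp_add]
    simp [p₀, p₁]
    ring
  have hr : mgf id ν θ = p₀ + b + ∫ a in Sᶜ, Real.exp (θ * a) ∂ν := by
    rw [← hSr, integral_add_compl hS hir]; rfl
  have hrest : 0 ≤ ∫ a in Sᶜ, Real.exp (θ * a) ∂ν := integral_nonneg fun _ => (Real.exp_pos _).le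
  have hM3 := h.mgf_le_three hθ1
  have hM1 := h.one_le_mgf hθ
  -- `p₀ + b ≤ φ(θ) ≤ 3` makes the loss from the two atoms uniform in `θ`.
  have hlow : p₀ * p₁ / 3 ≤ p₀ * b / (p₀ + b) := by
    rw [div_le_div_iff₀ (by norm_num) (by positivity)]
    have h1 : p₀ * p₁ ≤ p₀ * b := mul_le_mul_of_nonneg_left hb1 hp0.le
    have h2 : 0 < p₀ * p₁ := by positivity
    nlinarith
  have hcos : 2 / Real.pi ^ 2 * τ ^ 2 ≤ 1 - Real.cos τ := by
    linarith [Real.cos_le_one_sub_mul_cos_sq hτ]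
  have hkey : ‖complexMGF id ν z‖ ≤ mgf id ν θ - p₀ * p₁ / 3 * (1 - Real.cos τ) := by
    have e : complexMGF id ν z = ∫ a in S, Complex.exp (z * a) ∂ν
        + ∫ a in Sᶜ, Complex.exp (z * a) ∂ν := by
      rw [integral_add_compl hS hic]; rfl
    have h1 : ‖∫ a in Sᶜ, Complex.exp (z * a) ∂ν‖ ≤ ∫ a in Sᶜ, Real.exp (θ * a) ∂ν := by
      refine (norm_integral_le_integral_norm _).trans (le_of_eq ?_)
      simp only [hnorm]
    have h2 := norm_add_mul_exp_le (τ := τ) hp0 (hp1.trans_le hb1)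
    have h3 : p₀ * p₁ / 3 * (1 - Real.cos τ) ≤ p₀ * b / (p₀ + b) * (1 - Real.cos τ) :=
      mul_le_mul_of_nonneg_right hlow (by linarith [Real.cos_le_one τ])
    rw [e, hSc]
    linarith [norm_add_le ((p₀ : ℂ) + (b : ℂ) * Complex.exp (τ * Complex.I))
      (∫ a in Sᶜ, Complex.exp (z * a) ∂ν)]
  calc ‖complexMGF id ν z‖ ≤ mgf id ν θ - p₀ * p₁ / 3 * (1 - Real.cos τ) := hkey
    _ ≤ mgf id ν θ * (1 - p₀ * p₁ / 9 * (2 / Real.pi ^ 2) * τ ^ 2) := by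
        have h1 : p₀ * p₁ / 3 * (2 / Real.pi ^ 2 * τ ^ 2) ≤ p₀ * p₁ / 3 * (1 - Real.cos τ) :=
          mul_le_mul_of_nonneg_left hcos (by positivity)
        have h2 : 0 ≤ p₀ * p₁ / 9 * (2 / Real.pi ^ 2) * τ ^ 2 := by positivity
        nlinarith
    _ ≤ _ := by
        refine mul_le_mul_of_nonneg_left ?_ (by linarith)
        linarith [Real.add_one_le_exp (-(p₀ * p₁ / 9 * (2 / Real.pi ^ 2) * τ ^ 2))]

end PayoffLaw

/-! ### Detecting a tie by a tilted Fourier integral -/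

section Kernel

variable {k : ℕ} {Ω : Type*} {n : ℕ} {X : Fin n → Fin n → Ω → ℝ}

lemma score_eq_add_sum {i j : Fin n} (hij : i ≠ j) (ω : Ω) :
    score X i ω = X i j ω + ∑ w ∈ (Finset.univ.erase i).erase j, X i w ω :=
  (Finset.add_sum_erase _ _ (by simp [hij.symm])).symm

/-- Orthogonality of the characters of `ℤ`. -/
lemma integral_cexp_int_mul (m : ℤ) :
    ∫ τ in -Real.pi..Real.pi, Complex.exp (m * Complex.I * τ) =
      if m = 0 then (2 * Real.pi : ℂ) else 0 := by
  split_ifs with hm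
  · simp [hm]; ring
  · have hc : (m : ℂ) * Complex.I ≠ 0 := by simp [hm]
    rw [integral_exp_mul_complex hc, div_eq_zero_iff, sub_eq_zero]
    left
    have := Complex.exp_int_mul_two_pi_mul_I m
    rw [show (m : ℂ) * Complex.I * (Real.pi : ℝ) =
      m * Complex.I * (-Real.pi : ℝ) + m * (2 * Real.pi * Complex.I) by push_cast; ring,
      Complex.exp_add, this, mul_one]

/-- The exponentially tilted Fourier kernel `exp (θ (s_u + s_v) + i k τ (s_u - s_v))` for the event
that `u` and `v` tie, written as a joint Laplace transform of the two scores. -/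
def tieKernel (k : ℕ) (X : Fin n → Fin n → Ω → ℝ) (u v : Fin n) (θ τ : ℝ) (ω : Ω) : ℂ :=
  Complex.exp ((θ + (k * τ : ℝ) * Complex.I) * score X u ω +
    (θ + (k * -τ : ℝ) * Complex.I) * score X v ω)

lemma norm_tieKernel (u v : Fin n) (θ τ : ℝ) (ω : Ω) :
    ‖tieKernel k X u v θ τ ω‖ = Real.exp (θ * (score X u ω + score X v ω)) := by
  rw [tieKernel, Complex.norm_exp]
  simp
  ring

/-- Fourier inversion on the lattice of score differences, together with Chernoff's inequality,
bounds the indicator of a tie above the level `t`. -/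
lemma indicator_tie_le {u v : Fin n} {θ t : ℝ} (hk : 1 ≤ k) (hθ : 0 ≤ θ) {ω : Ω}
    (hω : ∃ m : ℤ, k * (score X u ω - score X v ω) = m) :
    {ω | t < score X u ω ∧ score X u ω = score X v ω}.indicator (fun _ => (1 : ℝ)) ω ≤
      Real.exp (-(2 * θ * t)) / (2 * Real.pi) *
        (∫ τ in -Real.pi..Real.pi, tieKernel k X u v θ τ ω).re := by
  obtain ⟨m, hm⟩ := hω
  have hker : ∀ τ : ℝ, tieKernel k X u v θ τ ω =
      (Real.exp (θ * (score X u ω + score X v ω)) : ℝ) * Complex.exp (m * Complex.I * τ) := by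
    intro τ
    have hm' : (m : ℂ) = k * (score X u ω - score X v ω) := by exact_mod_cast hm.symm
    rw [tieKernel, Complex.ofReal_exp, ← Complex.exp_add, hm']
    congr 1
    push_cast
    ring
  simp only [hker, intervalIntegral.integral_const_mul, integral_cexp_int_mul]
  have hk0 : (k : ℝ) ≠ 0 := by positivity
  by_cases hs : score X u ω = score X v ω
  · have hm0 : m = 0 := by
      rw [hs, sub_self, mul_zero] at hm
      exact_mod_cast hm.symm
    have hval : Real.exp (-(2 * θ * t)) / (2 * Real.pi) *
        (((Real.exp (θ * (score X u ω + score X v ω)) : ℝ) : ℂ) * (2 * Real.pi)).re =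
        Real.exp (θ * (2 * (score X u ω - t))) := by
      have : ((Real.exp (θ * (score X u ω + score X v ω)) : ℝ) : ℂ) * (2 * Real.pi) =
          ((Real.exp (θ * (score X u ω + score X v ω)) * (2 * Real.pi) : ℝ) : ℂ) := by
        push_cast; ring
      rw [this, Complex.ofReal_re, ← hs]
      have e : Real.exp (θ * (2 * (score X u ω - t))) = Real.exp (-(2 * θ * t)) *
          Real.exp (θ * (score X u ω + score X u ω)) := by
        rw [← Real.exp_add]; congr 1; ring
      rw [e]
      field_simp
    rw [if_pos hm0, hval]
    refine Set.indicator_apply_le' (fun hmem => Real.one_le_exp ?_) fun _ => (Real.exp_pos _).le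
    have := hmem.1
    exact mul_nonneg hθ (by linarith)
  · have hm0 : m ≠ 0 := by
      rintro rfl
      simp [hk0, sub_eq_zero] at hm
      exact hs hm
    rw [if_neg hm0, Set.indicator_of_notMem fun hmem => hs hmem.2]
    simp

end Kernel

/-! ### The joint transform of two scores -/

section Tournament

variable {k : ℕ} {ν : Measure ℝ} {Ω : Type*} [MeasurableSpace Ω] {P : Measure Ω} {n : ℕ}
  {X : Fin n → Fin n → Ω → ℝ}

/-- The payoffs of a family of distinct games are independent, whichever of the two players of
each game is looked at. -/
lemma IsTournament.iIndepFun_payoff (h : IsTournament k ν P n X) {ι : Type*}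
    {f : ι → Fin n × Fin n} (hne : ∀ a, (f a).1 ≠ (f a).2) (hinj : Function.Injective f)
    (hswap : ∀ a b, f a ≠ (f b).swap) :
    iIndepFun (fun a => X (f a).1 (f a).2) P := by
  classical
  let g : ι → {q : Fin n × Fin n // q.1 < q.2} := fun a =>
    if h : (f a).1 < (f a).2 then ⟨f a, h⟩
    else ⟨(f a).swap, lt_of_le_of_ne (not_lt.1 h) (hne a).symm⟩
  have hg : Function.Injective g := by
    intro a b hab
    by_cases ha : (f a).1 < (f a).2 <;> by_cases hb : (f b).1 < (f b).2 <;>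
      simp only [g, ha, hb, dif_pos, dif_neg, not_false_eq_true, Subtype.mk.injEq] at hab
    · exact hinj hab
    · exact absurd hab (hswap a b)
    · exact absurd hab.symm (hswap b a)
    · exact hinj (Prod.swap_injective hab)
  have hind := (h.indep.precomp hg).comp
    (fun a (p : ℝ × ℝ) => if (f a).1 < (f a).2 then p.1 else p.2) (fun a => by
      split_ifs
      exacts [measurable_fst, measurable_snd])
  convert hind using 1
  funext a ω
  by_cases ha : (f a).1 < (f a).2 <;> simp [g, ha]

lemma IsTournament.ae_mem_payoffs (h : IsTournament k ν P n X) :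
    ∀ᵐ ω ∂P, ∀ i j, i ≠ j → X i j ω ∈ payoffs k := by
  refine ae_all_iff.2 fun i => ae_all_iff.2 fun j => ?_
  by_cases hij : i = j
  · exact .of_forall fun _ hne => absurd hij hne
  have hc := h.payoffLaw.concentrated
  rw [← h.law i j hij] at hc
  exact (ae_of_ae_map (h.measurable i j hij).aemeasurable hc).mono fun _ hω _ => hω

lemma IsTournament.measurable_score (h : IsTournament k ν P n X) (i : Fin n) :
    Measurable (score X i) :=
  Finset.measurable_fun_sum _ fun j hj => h.measurable i j (Finset.ne_of_mem_erase hj).symm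

lemma IsTournament.integral_cexp_payoff (h : IsTournament k ν P n X) {i j : Fin n} (hij : i ≠ j)
    (z : ℂ) : ∫ ω, Complex.exp (z * X i j ω) ∂P = complexMGF id ν z := by
  rw [← h.law i j hij, complexMGF, integral_map (h.measurable i j hij).aemeasurable
    (by fun_prop)]
  rfl

/-- The joint Laplace transform of two scores factorises over the games: the game between the two
players contributes the first two factors, since its payoffs add up to `1`. -/
lemma IsTournament.integral_cexp_scores (h : IsTournament k ν P n X) {u v : Fin n} (huv : u ≠ v)
    (z₁ z₂ : ℂ) :
    ∫ ω, Complex.exp (z₁ * score X u ω + z₂ * score X v ω) ∂P =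
      Complex.exp z₂ * complexMGF id ν (z₁ - z₂) * complexMGF id ν z₁ ^ (n - 2) *
        complexMGF id ν z₂ ^ (n - 2) := by
  classical
  set W : Finset (Fin n) := (Finset.univ.erase u).erase v with hW
  have hWu : ∀ w : W, u ≠ w := fun w => by
    have := w.2; simp only [hW, Finset.mem_erase] at this; exact this.2.1.symm
  have hWv : ∀ w : W, v ≠ w := fun w => by
    have := w.2; simp only [hW, Finset.mem_erase] at this; exact this.1.symm
  have hcard : Fintype.card W = n - 2 := by
    rw [Fintype.card_coe, hW, Finset.card_erase_of_mem (by simp [huv.symm]),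
      Finset.card_erase_of_mem (Finset.mem_univ _), Finset.card_univ, Fintype.card_fin]
    omega
  let f : Option (W ⊕ W) → Fin n × Fin n
    | none => (u, v)
    | some (.inl w) => (u, w)
    | some (.inr w) => (v, w)
  let z : Option (W ⊕ W) → ℂ
    | none => z₁ - z₂
    | some (.inl _) => z₁
    | some (.inr _) => z₂
  have hne : ∀ a, (f a).1 ≠ (f a).2 := by
    rintro (_ | w | w)
    exacts [huv, hWu w, hWv w]
  have hinj : Function.Injective f := by
    rintro (_ | w | w) (_ | w' | w') hab <;>
      simp only [f, Prod.mk.injEq, Subtype.coe_inj] at hab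
    · rfl
    · exact absurd hab.2 (hWv w')
    · exact absurd hab.1 huv
    · exact absurd hab.2.symm (hWv w)
    · rw [hab.2]
    · exact absurd hab.1 huv
    · exact absurd hab.1.symm huv
    · exact absurd hab.1.symm huv
    · rw [hab.2]
  have hswap : ∀ a b, f a ≠ (f b).swap := by
    rintro (_ | w | w) (_ | w' | w') hab <;>
      simp only [f, Prod.swap_prod_mk, Prod.mk.injEq] at hab
    · exact huv hab.1
    · exact hWu w' hab.1
    · exact hWu w' hab.1
    · exact hWu w hab.2.symm
    · exact hWu w' hab.1
    · exact hWu w' hab.1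
    · exact hWu w hab.2.symm
    · exact hWv w' hab.1
    · exact hWv w' hab.1
  have hprod := (h.iIndepFun_payoff hne hinj hswap).integral_fun_prod_comp (𝕜 := ℂ)
    (f := fun a (x : ℝ) => Complex.exp (z a * x))
    (fun a => (h.measurable _ _ (hne a)).aemeasurable) (fun a => by fun_prop)
  simp only [fun a => h.integral_cexp_payoff (hne a) (z a)] at hprod
  have hae : ∀ᵐ ω ∂P, Complex.exp (z₁ * score X u ω + z₂ * score X v ω) =
      Complex.exp z₂ * ∏ a, Complex.exp (z a * X (f a).1 (f a).2 ω) := by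
    filter_upwards [h.add_eq_one u v huv] with ω hω
    have hv : score X v ω = 1 - X u v ω + ∑ w ∈ W, X v w ω := by
      rw [score_eq_add_sum huv.symm, Finset.erase_right_comm, ← hW]
      linarith
    rw [score_eq_add_sum huv, hv, ← Complex.exp_sum, ← Complex.exp_add]
    congr 1
    rw [Fintype.sum_option, Fintype.sum_sum_type]
    simp only [z, f]
    rw [← Finset.mul_sum, ← Finset.mul_sum, Finset.sum_coe_sort W fun w => (X u w ω : ℂ),
      Finset.sum_coe_sort W fun w => (X v w ω : ℂ)]
    push_cast
    ring
  rw [integral_congr_ae hae, integral_const_mul, hprod, Fintype.prod_option,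
    Fintype.prod_sum_type]
  simp only [z, Finset.prod_const, Finset.card_univ, hcard]
  ring

/-! ### The probability of a tie between two given players above a level -/

/-- Score differences lie almost surely in the lattice `k⁻¹ ℤ`. -/
lemma IsTournament.ae_exists_int (h : IsTournament k ν P n X) (hk : 1 ≤ k) :
    ∀ᵐ ω ∂P, ∀ u v, ∃ m : ℤ, k * (score X u ω - score X v ω) = m := by
  have hk0 : (k : ℝ) ≠ 0 := by positivity
  filter_upwards [h.ae_mem_payoffs] with ω hω
  have key : ∀ i, ∃ m : ℤ, k * score X i ω = m := by
    intro i
    have : ∀ j, ∃ m : ℤ, i ≠ j → k * X i j ω = m := fun j => by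
      by_cases hij : i = j
      · exact ⟨0, fun hne => absurd hij hne⟩
      · obtain ⟨l, -, hl⟩ := hω i j hij
        exact ⟨l, fun _ => by rw [hl]; field_simp; simp⟩
    choose m hm using this
    refine ⟨∑ j ∈ Finset.univ.erase i, m j, ?_⟩
    rw [score, Finset.mul_sum]
    push_cast
    exact Finset.sum_congr rfl fun j hj => hm j (Finset.ne_of_mem_erase hj).symm
  intro u v
  obtain ⟨a, ha⟩ := key u
  obtain ⟨b, hb⟩ := key v
  exact ⟨a - b, by push_cast; rw [mul_sub, ha, hb]⟩

lemma IsTournament.ae_score_le (h : IsTournament k ν P n X) :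
    ∀ᵐ ω ∂P, ∀ i, score X i ω ≤ n := by
  filter_upwards [h.ae_mem_payoffs] with ω hω i
  calc score X i ω ≤ ∑ j ∈ Finset.univ.erase i, (1 : ℝ) := Finset.sum_le_sum fun j hj =>
        (mem_Icc_of_mem_payoffs (hω i j (Finset.ne_of_mem_erase hj).symm)).2
    _ ≤ n := by
        rw [Finset.sum_const, nsmul_eq_mul, mul_one]
        exact_mod_cast (Finset.card_le_univ _).trans_eq (Fintype.card_fin n)

lemma IsTournament.integrable_tieKernel [IsProbabilityMeasure P] (h : IsTournament k ν P n X)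
    (u v : Fin n) {θ : ℝ} (hθ : 0 ≤ θ) :
    Integrable (Function.uncurry fun ω τ => tieKernel k X u v θ τ ω)
      (P.prod (volume.restrict (Set.Ioc (-Real.pi) Real.pi))) := by
  have hu := h.measurable_score u
  have hv := h.measurable_score v
  have hb : Integrable (fun ω => Real.exp (θ * (score X u ω + score X v ω))) P := by
    refine .of_bound (by fun_prop) (Real.exp (θ * (n + n))) ?_
    filter_upwards [h.ae_score_le] with ω hω
    rw [Real.norm_eq_abs, abs_of_pos (Real.exp_pos _)]
    exact Real.exp_le_exp.2 (mul_le_mul_of_nonneg_left (add_le_add (hω u) (hω v)) hθ)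
  refine (hb.comp_fst (volume.restrict (Set.Ioc (-Real.pi) Real.pi))).mono' ?_
    (.of_forall fun p => (norm_tieKernel u v θ p.2 p.1).le)
  refine Measurable.aestronglyMeasurable ?_
  unfold tieKernel Function.uncurry
  fun_prop

/-- Chernoff's bound for a tie of two players above the level `t`. The factor with the square
root, of order `n ^ (-1/2)`, is the price of the exact equality of the scores. -/
lemma IsTournament.measureReal_tie_le [IsProbabilityMeasure P] (h : IsTournament k ν P n X)
    (hk : 1 ≤ k) (hn : 3 ≤ n) {u v : Fin n} (huv : u ≠ v) {c : ℝ} (hc : 0 < c) {θ : ℝ}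
    (hθ : 0 ≤ θ)
    (hchar : ∀ τ : ℝ, |τ| ≤ Real.pi →
      ‖complexMGF id ν (θ + (k * τ : ℝ) * Complex.I)‖ ≤
        mgf id ν θ * Real.exp (-(c * τ ^ 2))) (t : ℝ) :
    P.real {ω | t < score X u ω ∧ score X u ω = score X v ω} ≤
      Real.exp (θ - 2 * θ * t) * mgf id ν θ ^ (2 * (n - 2)) *
        √(Real.pi / (2 * ((n - 2 : ℕ) : ℝ) * c)) := by
  have := h.payoffLaw.isProbabilityMeasure
  have hpi := Real.pi_pos
  have hm0 : (0 : ℝ) < ((n - 2 : ℕ) : ℝ) := by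
    have : 0 < n - 2 := by omega
    exact_mod_cast this
  set m := n - 2
  set M := mgf id ν θ with hM
  have hM0 : 0 ≤ M := mgf_nonneg
  have hmeas : MeasurableSet {ω | t < score X u ω ∧ score X u ω = score X v ω} :=
    (measurableSet_lt measurable_const (h.measurable_score u)).inter
      (measurableSet_eq_fun (h.measurable_score u) (h.measurable_score v))
  have hint := h.integrable_tieKernel u v hθ
  have hpp : -Real.pi ≤ Real.pi := by linarith
  have hinner : ∀ τ : ℝ, |τ| ≤ Real.pi → ‖∫ ω, tieKernel k X u v θ τ ω ∂P‖ ≤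
      Real.exp θ * M ^ (2 * m) * Real.exp (-(2 * m * c) * τ ^ 2) := by
    intro τ hτ
    have h1 : ‖complexMGF id ν ((θ + (k * τ : ℝ) * Complex.I) -
        (θ + (k * -τ : ℝ) * Complex.I))‖ ≤ 1 := by
      refine norm_complexMGF_le_mgf.trans (le_of_eq ?_)
      simp
    have h2 : ‖Complex.exp (θ + (k * -τ : ℝ) * Complex.I)‖ = Real.exp θ := by
      rw [Complex.norm_exp]; simp
    simp only [tieKernel]
    rw [h.integral_cexp_scores huv, norm_mul, norm_mul, norm_mul, norm_pow, norm_pow, h2]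
    calc _ ≤ Real.exp θ * 1 * (M * Real.exp (-(c * τ ^ 2))) ^ m *
          (M * Real.exp (-(c * (-τ) ^ 2))) ^ m := by
          gcongr
          · exact hchar τ hτ
          · exact hchar (-τ) (by rwa [abs_neg])
      _ = _ := by
          have e : Real.exp (-(2 * m * c) * τ ^ 2) = Real.exp (-(c * τ ^ 2)) ^ (2 * m) := by
            rw [← Real.exp_nat_mul]; congr 1; push_cast; ring
          rw [e, neg_sq]; ring
  have hb : (0 : ℝ) < 2 * m * c := by positivity
  have hg := integrable_exp_neg_mul_sq hb
  have houter : ‖∫ τ in Set.Ioc (-Real.pi) Real.pi, ∫ ω, tieKernel k X u v θ τ ω ∂P‖ ≤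
      Real.exp θ * M ^ (2 * m) * √(Real.pi / (2 * m * c)) := by
    calc _ ≤ ∫ τ in Set.Ioc (-Real.pi) Real.pi,
          Real.exp θ * M ^ (2 * m) * Real.exp (-(2 * m * c) * τ ^ 2) := by
          refine norm_integral_le_of_norm_le (hg.const_mul _).integrableOn ?_
          filter_upwards [ae_restrict_mem measurableSet_Ioc] with τ hτ
          exact hinner τ (abs_le.2 ⟨hτ.1.le, hτ.2⟩)
      _ = Real.exp θ * M ^ (2 * m) * ∫ τ in Set.Ioc (-Real.pi) Real.pi,
          Real.exp (-(2 * m * c) * τ ^ 2) := integral_const_mul _ _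
      _ ≤ _ := by
          rw [← integral_gaussian]
          exact mul_le_mul_of_nonneg_left
            (setIntegral_le_integral hg (.of_forall fun _ => (Real.exp_pos _).le)) (by positivity)
  have hreint : Integrable (fun ω =>
      (∫ τ in -Real.pi..Real.pi, tieKernel k X u v θ τ ω).re) P := by
    simp only [intervalIntegral.integral_of_le hpp]
    exact hint.integral_prod_left.re
  calc P.real {ω | t < score X u ω ∧ score X u ω = score X v ω}
      = ∫ ω, {ω | t < score X u ω ∧ score X u ω = score X v ω}.indicator
          (fun _ => (1 : ℝ)) ω ∂P := by rw [integral_indicator_const _ hmeas]; simp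
    _ ≤ ∫ ω, Real.exp (-(2 * θ * t)) / (2 * Real.pi) *
          (∫ τ in -Real.pi..Real.pi, tieKernel k X u v θ τ ω).re ∂P := by
        refine integral_mono_ae ((integrable_const _).indicator hmeas) (hreint.const_mul _) ?_
        filter_upwards [h.ae_exists_int hk] with ω hω
        exact indicator_tie_le hk hθ (hω u v)
    _ = Real.exp (-(2 * θ * t)) / (2 * Real.pi) *
          (∫ τ in Set.Ioc (-Real.pi) Real.pi, ∫ ω, tieKernel k X u v θ τ ω ∂P).re := by
        simp only [intervalIntegral.integral_of_le hpp]
        rw [integral_const_mul, ← integral_integral_swap hint]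
        congr 1
        exact integral_re hint.integral_prod_left
    _ ≤ Real.exp (-(2 * θ * t)) * (Real.exp θ * M ^ (2 * m) * √(Real.pi / (2 * m * c))) := by
        have h1 : Real.exp (-(2 * θ * t)) / (2 * Real.pi) ≤ Real.exp (-(2 * θ * t)) :=
          div_le_self (Real.exp_pos _).le (by linarith [Real.pi_gt_three])
        refine mul_le_mul_of_nonneg h1 ((Complex.re_le_norm _).trans houter)
          (by positivity) (by positivity)
    _ = _ := by
        rw [sub_eq_add_neg θ, Real.exp_add]; ring

end Tournament

/-! ### The level `t_n` and the union bound -/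

/-- At the tilt `θ = x_n / (σ √(n - 1))` the linear terms cancel and the quadratic ones leave
`-x_n ^ 2`, twice the Gaussian exponent of a single score. -/
lemma IsPayoffLaw.exp_mul_mgf_pow_le {k : ℕ} {ν : Measure ℝ} (h : IsPayoffLaw k ν) {ε θ : ℝ}
    {n : ℕ} (hn : 1 ≤ n) (hθ : 0 ≤ θ) (hθ1 : θ ≤ 1)
    (hx : θ * (payoffStd ν * √((n : ℝ) - 1)) = xSeq ε n) :
    Real.exp (θ - 2 * θ * threshold ν ε n) * mgf id ν θ ^ (2 * (n - 2)) ≤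
      Real.exp (θ + 2 * (((n : ℝ) - 1) * θ ^ 3) - xSeq ε n ^ 2) := by
  have hM1 := h.one_le_mgf hθ
  have hy : (0 : ℝ) ≤ (n : ℝ) - 1 := by
    have : (1 : ℝ) ≤ n := by exact_mod_cast hn
    linarith
  have hcast : ((2 * (n - 1) : ℕ) : ℝ) = 2 * ((n : ℝ) - 1) := by push_cast [hn]; ring
  calc _ ≤ Real.exp (θ - 2 * θ * threshold ν ε n) *
        Real.exp (θ * payoffMean ν + θ ^ 2 * payoffStd ν ^ 2 / 2 + θ ^ 3) ^ (2 * (n - 1)) := by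
        refine mul_le_mul_of_nonneg_left ?_ (Real.exp_pos _).le
        exact (pow_le_pow_right₀ hM1 (by omega)).trans
          (pow_le_pow_left₀ (by linarith) (h.mgf_le hθ hθ1) _)
    _ = _ := by
        rw [← Real.exp_nat_mul, ← Real.exp_add, hcast, threshold, ← hx]
        congr 1
        have hs := Real.sq_sqrt hy
        linear_combination (-θ ^ 2 * payoffStd ν ^ 2) * hs

/-- For `y = n - 1` and `x = x_n`, the tilt `x / (σ √y)` is eventually in the range where the
expansion of the moment generating function is valid, and its cubic error is bounded. The third
claim needs `y` large because the square root defining `x` has to be taken of a nonnegative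
number. -/
lemma eventually_level_bounds {ε σ : ℝ} (hε : 0 < ε) (hσ : 0 < σ) :
    ∀ᶠ y : ℝ in atTop, ∀ x : ℝ,
      x = √(2 * Real.log y - (1 + ε) * Real.log (Real.log y)) →
      x / (σ * √y) ≤ 1 ∧ y * (x / (σ * √y)) ^ 3 ≤ 1 ∧
        Real.exp (-x ^ 2) = Real.log y ^ (1 + ε) / y ^ 2 := by
  have h1 := (Real.isLittleO_pow_log_id_atTop (n := 1)).def (c := σ ^ 2 / 2) (by positivity)
  have h3 := (Real.isLittleO_pow_log_id_atTop (n := 3)).def (c := σ ^ 6 / 8) (by positivity)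
  have hll := ((Real.isLittleO_pow_log_id_atTop (n := 1)).comp_tendsto Real.tendsto_log_atTop).def
    (c := 2 / (1 + ε)) (by positivity)
  filter_upwards [h1, h3, hll, eventually_ge_atTop (Real.exp 1)] with y h1 h3 hll hy x hx
  have hy0 : 0 < y := (Real.exp_pos 1).trans_le hy
  have hL : 1 ≤ Real.log y := (Real.le_log_iff_exp_le hy0).2 hy
  have hLL : 0 ≤ Real.log (Real.log y) := Real.log_nonneg hL
  simp only [pow_one, Real.norm_eq_abs, id, Function.comp_apply, abs_pow] at h1 h3 hll
  rw [abs_of_nonneg (by linarith), abs_of_pos hy0] at h1 h3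
  rw [abs_of_nonneg hLL, abs_of_nonneg (by linarith), div_mul_eq_mul_div,
    le_div_iff₀ (by positivity)] at hll
  have hx0 : 0 ≤ x := hx ▸ Real.sqrt_nonneg _
  have hxx : x ^ 2 = 2 * Real.log y - (1 + ε) * Real.log (Real.log y) := by
    rw [hx, Real.sq_sqrt (by linarith)]
  have hxL : x ^ 2 ≤ 2 * Real.log y := by
    have : 0 ≤ (1 + ε) * Real.log (Real.log y) := by positivity
    linarith
  have hsy := Real.sq_sqrt hy0.le
  have hsy0 : 0 < √y := Real.sqrt_pos.2 hy0
  refine ⟨?_, ?_, ?_⟩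
  · refine (sq_le_one_iff₀ (by positivity)).1 ?_
    rw [div_pow, mul_pow, hsy, div_le_one (by positivity)]
    nlinarith
  · refine (sq_le_one_iff₀ (by positivity)).1 ?_
    have e : (y * (x / (σ * √y)) ^ 3) ^ 2 = (x ^ 2) ^ 3 / (σ ^ 6 * y) := by
      have : (y * (x / (σ * √y)) ^ 3) ^ 2 = y ^ 2 * (x ^ 2) ^ 3 / (σ ^ 6 * (√y ^ 2) ^ 3) := by
        field_simp
      rw [this, hsy]; field_simp
    rw [e, div_le_one (by positivity)]
    have := pow_le_pow_left₀ (sq_nonneg x) hxL 3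
    nlinarith [pow_pos hσ 6]
  · have hL0 : 0 < Real.log y := by linarith
    rw [Real.rpow_def_of_pos hL0, hxx, ← Real.exp_log hy0, ← Real.exp_nat_mul, ← Real.exp_sub,
      Real.exp_log hy0]
    congr 1; push_cast; ring

lemma measureReal_tiedPairs_ne_zero_le {Ω : Type*} [MeasurableSpace Ω] (P : Measure Ω)
    [IsFiniteMeasure P] {n : ℕ} (X : Fin n → Fin n → Ω → ℝ) (t : ℝ) {B : ℝ} (hB0 : 0 ≤ B)
    (hB : ∀ u v, u ≠ v → P.real {ω | t < score X u ω ∧ score X u ω = score X v ω} ≤ B) :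
    P.real {ω | tiedPairs X t ω = 0}ᶜ ≤ (n : ℝ) ^ 2 * B := by
  classical
  have hsub : {ω | tiedPairs X t ω = 0}ᶜ ⊆ ⋃ q ∈ (Finset.univ : Finset (Fin n)).offDiag,
      {ω | t < score X q.1 ω ∧ score X q.1 ω = score X q.2 ω} := by
    intro ω hω
    by_contra hcon
    simp only [Set.mem_iUnion, not_exists] at hcon
    refine hω (Finset.sum_eq_zero fun v _ => Finset.sum_eq_zero fun u hu => if_neg fun htie => ?_)
    exact hcon (u, v) (by simp [(Finset.mem_Ioi.1 hu).ne']) htie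
  calc P.real {ω | tiedPairs X t ω = 0}ᶜ
      ≤ ∑ q ∈ (Finset.univ : Finset (Fin n)).offDiag,
          P.real {ω | t < score X q.1 ω ∧ score X q.1 ω = score X q.2 ω} :=
        (measureReal_mono hsub (measure_ne_top _ _)).trans (measureReal_biUnion_finset_le _ _)
    _ ≤ ∑ q ∈ (Finset.univ : Finset (Fin n)).offDiag, B :=
        Finset.sum_le_sum fun q hq =>
          hB q.1 q.2 (Finset.mem_offDiag.1 hq).2.2
    _ ≤ (n : ℝ) ^ 2 * B := by
        rw [Finset.sum_const, nsmul_eq_mul]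
        refine mul_le_mul_of_nonneg_right ?_ hB0
        rw [Finset.offDiag_card, Finset.card_univ, Fintype.card_fin, sq]
        exact_mod_cast Nat.sub_le _ _

end RoundRobin

end

theorem proposition3 (k : ℕ) (hk : 1 ≤ k) (ν : Measure ℝ) (ε : ℝ) (hε : 0 < ε)
    {Ω : ℕ → Type*} [∀ n, MeasurableSpace (Ω n)]
    (P : ∀ n, Measure (Ω n)) [∀ n, IsProbabilityMeasure (P n)]
    (X : ∀ n, Fin n → Fin n → Ω n → ℝ)
    (hX : ∀ n, RoundRobin.IsTournament k ν (P n) n (X n)) :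
    Tendsto (fun n : ℕ =>
        P n {ω | RoundRobin.tiedPairs (X n) (RoundRobin.threshold ν ε n) ω = 0})
      atTop (𝓝 1) := by
  open RoundRobin in
  have hν := (hX 0).payoffLaw
  have hσ := hν.payoffStd_pos hk
  obtain ⟨c, hc, hchar⟩ := hν.exists_norm_complexMGF_le hk
  have hy : Tendsto (fun n : ℕ => (n : ℝ) - 1) atTop atTop :=
    tendsto_atTop_add_const_right _ (-1) tendsto_natCast_atTop_atTop
  -- `n ^ 2 * exp (-x_n ^ 2)` is of order `(log n) ^ (1 + ε)`, and the equality of the two scores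
  -- contributes the factor `n ^ (-1 / 2)`.
  have hlim : Tendsto (fun n : ℕ => 4 * Real.exp 3 * √(Real.pi / c) *
      (Real.log ((n : ℝ) - 1) ^ (1 + ε) / ((n : ℝ) - 1) ^ (1 / 2 : ℝ))) atTop (𝓝 0) := by
    have := ((isLittleO_log_rpow_rpow_atTop (1 + ε) (s := 1 / 2)
      (by norm_num)).tendsto_div_nhds_zero.comp hy).const_mul (4 * Real.exp 3 * √(Real.pi / c))
    simpa using this
  have hbound : ∀ᶠ n : ℕ in atTop,
      (P n).real {ω | tiedPairs (X n) (threshold ν ε n) ω = 0}ᶜ ≤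
        4 * Real.exp 3 * √(Real.pi / c) *
          (Real.log ((n : ℝ) - 1) ^ (1 + ε) / ((n : ℝ) - 1) ^ (1 / 2 : ℝ)) := by
    filter_upwards [hy.eventually (eventually_level_bounds hε hσ), eventually_ge_atTop 3]
      with n hlev hn
    obtain ⟨hθ1, hθ3, hexp⟩ := hlev (xSeq ε n) rfl
    have hn' : (3 : ℝ) ≤ n := by exact_mod_cast hn
    set y : ℝ := (n : ℝ) - 1 with hydef
    have hy0 : 0 < y := by linarith
    have hsy : 0 < √y := Real.sqrt_pos.2 hy0
    set θ := xSeq ε n / (payoffStd ν * √y) with hθdef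
    have hθ : 0 ≤ θ := div_nonneg (Real.sqrt_nonneg _) (by positivity)
    have hL : 0 ≤ Real.log y := Real.log_nonneg (by linarith)
    have hx : θ * (payoffStd ν * √((n : ℝ) - 1)) = xSeq ε n :=
      div_mul_cancel₀ _ (by positivity)
    have hpair : ∀ u v : Fin n, u ≠ v → (P n).real {ω | threshold ν ε n < score (X n) u ω ∧
        score (X n) u ω = score (X n) v ω} ≤
        Real.exp 3 * (Real.log y ^ (1 + ε) / y ^ 2) * √(Real.pi / (c * y)) := by
      intro u v huv
      refine ((hX n).measureReal_tie_le hk hn huv hc hθ (hchar θ hθ hθ1) _).trans ?_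
      refine mul_le_mul ?_ (Real.sqrt_le_sqrt ?_) (Real.sqrt_nonneg _) (by positivity)
      · refine (hν.exp_mul_mgf_pow_le (by omega) hθ hθ1 hx).trans ?_
        rw [← hexp, ← Real.exp_add]
        exact Real.exp_le_exp.2 (by linarith)
      · refine div_le_div_of_nonneg_left Real.pi_pos.le (by positivity) ?_
        have : y ≤ 2 * ((n - 2 : ℕ) : ℝ) := by
          rw [Nat.cast_sub (by omega)]; push_cast; linarith
        nlinarith
    refine (measureReal_tiedPairs_ne_zero_le (P n) (X n) _ (by positivity) hpair).trans ?_
    have hsplit : √(Real.pi / (c * y)) = √(Real.pi / c) / y ^ (1 / 2 : ℝ) := by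
      rw [← div_div, Real.sqrt_div (by positivity), Real.sqrt_eq_rpow y]
    have hn2 : (n : ℝ) ^ 2 ≤ 4 * y ^ 2 := by nlinarith
    calc _ ≤ 4 * y ^ 2 *
          (Real.exp 3 * (Real.log y ^ (1 + ε) / y ^ 2) * √(Real.pi / (c * y))) :=
          mul_le_mul_of_nonneg_right hn2 (by positivity)
      _ = _ := by
          rw [hsplit]; field_simp
  have hcompl : Tendsto (fun n : ℕ =>
      (P n).real {ω | tiedPairs (X n) (threshold ν ε n) ω = 0}ᶜ) atTop (𝓝 0) :=
    squeeze_zero' (.of_forall fun _ => measureReal_nonneg) hbound hlim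
  have hreal : Tendsto (fun n : ℕ =>
      (P n).real {ω | tiedPairs (X n) (threshold ν ε n) ω = 0}) atTop (𝓝 1) := by
    refine tendsto_of_tendsto_of_tendsto_of_le_of_le
      (by simpa using hcompl.const_sub 1) tendsto_const_nhds (fun n => ?_)
      fun n => measureReal_le_one
    have := measureReal_union_le (μ := P n)
      {ω | tiedPairs (X n) (threshold ν ε n) ω = 0}
      {ω | tiedPairs (X n) (threshold ν ε n) ω = 0}ᶜ
    rw [Set.union_compl_self, probReal_univ] at this
    simpa [sub_le_iff_le_add] using this
  have := ENNReal.tendsto_ofReal hreal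
  simpa [measureReal_def] using this
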